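/- **Conventions.** A *copy-discard category* is a symmetric monoidal category in which every object $X$ carries a commutative comonoid $\nu_X:X\to X\otimes X$, $\varepsilon_X:X\to I$, compatible with the tensor ($\nu_{X\otimes Y}$ and $\varepsilon_{X\otimes Y}$ are the tensor comonoid of the factors, and the comonoid on $I$ is the identity up to coherence). A morphism $f:X\to Y$ is *deterministic* if $f;\nu_Y=\nu_X;(f\otimes f)$, and *total* if $f;\varepsilon_Y=\varepsilon_X$. For $f:X\to A$ and $g:A\otimes X\to B$, let $f\triangleleft g:X\to A\otimes B$ be $\nu_X;(f\otimes \mathrm{id}_X);(\nu_A\otimes \mathrm{id}_X);(\mathrm{id}_A\otimes g)$. For $p:X\to I$ and $g:X\to Y$, write $p\triangleleft g:X\to Y$ as well, identifying $I\otimes X\cong X$ and $I\otimes Y\cong Y$. A *conditional* of $f:X\to Y_1\otimes Y_2$ is a morphism $c:Y_1\otimes X\to Y_2$ with $f=(f;\pi_1)\triangleleft c$, where $\pi_1=\mathrm{id}_{Y_1}\otimes\varepsilon_{Y_2}$; a *normalisation* of $f:X\to Y$ is a morphism $n:X\to Y$ with $f=(f;\varepsilon_Y)\triangleleft n$. A *partial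 Markov category* is a copy-discard category in which every $f:X\to Y_1\otimes Y_2$ has a conditional; a *Markov category* is a partial Markov category in which all morphisms are total. For a copy-discard category $\mathbb C$, the copy-discard category $\mathrm{exact}(\mathbb C)$ has the objects of $\mathbb C$; its morphisms are the formal sequential and parallel composites of morphisms of $\mathbb C$ and of generators $x^\circ:X\to I$, one for each deterministic $x:I\to X$ of $\mathbb C$, modulo the congruence generated by the axioms of symmetric monoidal categories, the composition and the tensor of $\mathbb C$, and the equations $(x\otimes y)^\circ=x^\circ\otimes y^\circ$, $\mathrm{id}_I^\circ=\mathrm{id}_I$ and $\nu_X;(x^\circ\otimes\mathrm{id}_X)=x^\circ;x$ (up to unitors). Its copy and discard morphisms are those of $\mathbb C$. A *normal form* from $X$ to $Y$ consists of an object $Z$ and morphisms $h:X\to Z$, $z:I\to Z$ deterministic, and $g:X\to Y$, all in $\mathbb C$; its value is the morphism $(h;z^\circ)\triangleleft g:X\to Y$ of $\mathrm{exact}(\mathbb C)$. **Theorem 5.4.** Let $\mathbb C$ be a Markov category. Then $\mathrm{exact}(\mathbb C)$ is a partial Markov category, and its conditionals can be computed from conditionals in $\mathbb C$, in the following sense.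 1. Every morphism $f:X\to Y$ of $\mathrm{exact}(\mathbb C)$ is the value of some normal form. 2. If $f=(h;z^\circ)\triangleleft g$ is the value of a normal form, then $g$ is a normalisation of $f$ in $\mathrm{exact}(\mathbb C)$. 3. If moreover $g:X\to Y_1\otimes Y_2$ and $c:Y_1\otimes X\to Y_2$ is a conditional of $g$ in $\mathbb C$, then $c$ is a conditional of $f$ in $\mathrm{exact}(\mathbb C)$. 4. Given any operation that assigns to every morphism $X\to Y_1\otimes Y_2$ of $\mathbb C$ one of its conditionals in $\mathbb C$, a normal form $(h,z,g)$ with value $f$ is computed by recursion on any formal expression for $f$, as follows; for $f:X\to Y_1\otimes Y_2$, the conditional assigned to this $g$ is then a conditional of $f$ in $\mathrm{exact}(\mathbb C)$. A morphism $f$ of $\mathbb C$ has the normal form $(\varepsilon,\mathrm{id}_I,f)$; an observation $x^\circ:X\to I$ has the normal form $(\mathrm{id}_X,x,\varepsilon_X)$; the tensor of expressions with normal forms $(h_1,z_1,g_1)$ and $(h_2,z_2,g_2)$ has the normal form $(h_1\otimes h_2,\ z_1\otimes z_2,\ g_1\otimes g_2)$; and the composite $X\to Y\to W$ of expressions with normal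 forms $(h_1,z_1,g_1)$ and $(h_2,z_2,g_2)$ has the normal form $(\nu_X;(h_1\otimes(g_1;h_2)),\ z_1\otimes z_2,\ (z_2\otimes\mathrm{id}_X);b;g_2)$, where $z_2:I\to Z_2$ and $b:Z_2\otimes X\to Y$ is the conditional assigned to $g_1;\nu_Y;(h_2\otimes\mathrm{id}_Y):X\to Z_2\otimes Y$. -/

import Mathlib

open CategoryTheory MonoidalCategory ComonObj

universe v u

namespace PartialMarkov

section CopyDiscard

variable {C : Type u} [Category.{v} C] [MonoidalCategory C] [CopyDiscardCategory C]

/-- A morphism is deterministic if it commutes with copying. (Totality is not required here: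
Mathlib's `Deterministic` also asks for compatibility with discarding, which is automatic in a
Markov category.) -/
def IsDeterministic {X Y : C} (f : X ⟶ Y) : Prop :=
  f ≫ Δ[Y] = Δ[X] ≫ (f ⊗ₘ f)

/-- The conditional composition `f ◁ g : X ⟶ A ⊗ B` of `f : X ⟶ A` and `g : A ⊗ X ⟶ B`: run `f` on
a copy of the input, output a copy of its result, and pass the result and the input to `g`. -/
def condComp {X A B : C} (f : X ⟶ A) (g : A ⊗ X ⟶ B) : X ⟶ A ⊗ B :=
  Δ[X] ≫ f ▷ X ≫ Δ[A] ▷ X ≫ (α_ A A X).hom ≫ A ◁ g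

/-- The conditional composition of an effect `p : X ⟶ I` with `g : X ⟶ Y`, where `I ⊗ X` and `I ⊗ Y`
are identified with `X` and `Y` through the left unitors. -/
def effectComp {X Y : C} (p : X ⟶ 𝟙_ C) (g : X ⟶ Y) : X ⟶ Y :=
  condComp p ((λ_ X).hom ≫ g) ≫ (λ_ Y).hom

/-- The first projection out of a tensor product: discard the second factor. -/
def proj₁ (X Y : C) : X ⊗ Y ⟶ X :=
  X ◁ ε[Y] ≫ (ρ_ X).hom

/-- `c` is a conditional of `f : X ⟶ Y₁ ⊗ Y₂` with respect to `Y₁`: composing the first marginal of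
`f` conditionally with `c` gives back `f`. -/
def IsConditional {X Y₁ Y₂ : C} (f : X ⟶ Y₁ ⊗ Y₂) (c : Y₁ ⊗ X ⟶ Y₂) : Prop :=
  f = condComp (f ≫ proj₁ Y₁ Y₂) c

/-- `n` is a normalisation of `f`. -/
def IsNormalisation {X Y : C} (f n : X ⟶ Y) : Prop :=
  f = effectComp (f ≫ ε[Y]) n

variable (C) in
/-- A copy-discard category has conditionals if every morphism into a tensor product has a
conditional. A partial Markov category is a copy-discard category with conditionals; a Markov
category (in the convention used here) is a partial Markov category in which all morphisms are
total, that is, `[MarkovCategory C] [HasConditionals C]`. -/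
class HasConditionals : Prop where
  exists_conditional {X Y₁ Y₂ : C} (f : X ⟶ Y₁ ⊗ Y₂) : ∃ c : Y₁ ⊗ X ⟶ Y₂, IsConditional f c

theorem IsDeterministic.id (X : C) : IsDeterministic (𝟙 X) := by
  simp [IsDeterministic]

theorem IsDeterministic.comp {X Y Z : C} {f : X ⟶ Y} {g : Y ⟶ Z}
    (hf : IsDeterministic f) (hg : IsDeterministic g) : IsDeterministic (f ≫ g) := by
  unfold IsDeterministic at *
  rw [Category.assoc, hg, ← Category.assoc, hf, Category.assoc, tensorHom_comp_tensorHom]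

theorem IsDeterministic.tensor {X Y X' Y' : C} {f : X ⟶ Y} {g : X' ⟶ Y'}
    (hf : IsDeterministic f) (hg : IsDeterministic g) : IsDeterministic (f ⊗ₘ g) := by
  unfold IsDeterministic at *
  rw [CopyDiscardCategory.copy_tensor, CopyDiscardCategory.copy_tensor, ← Category.assoc,
    tensorHom_comp_tensorHom, hf, hg, ← tensorHom_comp_tensorHom, Category.assoc, tensorμ_natural,
    Category.assoc]

theorem isDeterministic_leftUnitor_inv : IsDeterministic (λ_ (𝟙_ C)).inv := by
  unfold IsDeterministic
  rw [CopyDiscardCategory.copy_tensor, CopyDiscardCategory.copy_unit]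
  congr 1
  rw [← cancel_mono ((λ_ (𝟙_ C)).hom ▷ (𝟙_ C ⊗ 𝟙_ C) ≫ (λ_ (𝟙_ C ⊗ 𝟙_ C)).hom),
    Category.assoc, ← leftUnitor_monoidal (𝟙_ C) (𝟙_ C), tensorHom_comp_tensorHom]
  monoidal

/-- The parallel composition `I ≅ I ⊗ I ⟶ X ⊗ Y` of two morphisms without inputs. -/
def stateTensor {X Y : C} (x : 𝟙_ C ⟶ X) (y : 𝟙_ C ⟶ Y) : 𝟙_ C ⟶ X ⊗ Y :=
  (λ_ (𝟙_ C)).inv ≫ (x ⊗ₘ y)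

theorem IsDeterministic.stateTensor {X Y : C} {x : 𝟙_ C ⟶ X} {y : 𝟙_ C ⟶ Y}
    (hx : IsDeterministic x) (hy : IsDeterministic y) : IsDeterministic (stateTensor x y) :=
  isDeterministic_leftUnitor_inv.comp (hx.tensor hy)

end CopyDiscard

section Exact

variable (C : Type u) [Category.{v} C] [MonoidalCategory C] [CopyDiscardCategory C]

/-- Formal expressions for processes with exact observations: the morphisms of `C` and an
observation `X ⟶ I` for every deterministic `x : I ⟶ X`, combined by formal sequential and parallel
composition. -/
inductive Term : C → C → Type (max u v)
  | of {X Y : C} (f : X ⟶ Y) : Term X Y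
  | obs {X : C} (x : 𝟙_ C ⟶ X) (hx : IsDeterministic x) : Term X (𝟙_ C)
  | comp {X Y Z : C} (s : Term X Y) (t : Term Y Z) : Term X Z
  | tensor {X Y X' Y' : C} (s : Term X Y) (t : Term X' Y') : Term (X ⊗ X') (Y ⊗ Y')

variable {C}

/-- The congruence on formal expressions generated by the axioms of symmetric monoidal categories
(with the structural morphisms, the copies and the discards of `C`), by the equations that hold in
`C`, and by the three axioms for observations. -/
inductive Term.Rel : ∀ {X Y : C}, Term C X Y → Term C X Y → Prop
  -- equivalence relation and congruence
  | refl {X Y : C} (s : Term C X Y) : Rel s s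
  | symm {X Y : C} {s t : Term C X Y} : Rel s t → Rel t s
  | trans {X Y : C} {s t r : Term C X Y} : Rel s t → Rel t r → Rel s r
  | comp_congr {X Y Z : C} {s s' : Term C X Y} {t t' : Term C Y Z} :
      Rel s s' → Rel t t' → Rel (s.comp t) (s'.comp t')
  | tensor_congr {X Y X' Y' : C} {s s' : Term C X Y} {t t' : Term C X' Y'} :
      Rel s s' → Rel t t' → Rel (s.tensor t) (s'.tensor t')
  -- category
  | id_comp {X Y : C} (s : Term C X Y) : Rel ((Term.of (𝟙 X)).comp s) s
  | comp_id {X Y : C} (s : Term C X Y) : Rel (s.comp (Term.of (𝟙 Y))) s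
  | assoc {X Y Z W : C} (s : Term C X Y) (t : Term C Y Z) (r : Term C Z W) :
      Rel ((s.comp t).comp r) (s.comp (t.comp r))
  -- composition and tensor of morphisms of `C` are those of `C`
  | of_comp {X Y Z : C} (f : X ⟶ Y) (g : Y ⟶ Z) :
      Rel (Term.of (f ≫ g)) ((Term.of f).comp (Term.of g))
  | of_tensor {X Y X' Y' : C} (f : X ⟶ Y) (g : X' ⟶ Y') :
      Rel (Term.of (f ⊗ₘ g)) ((Term.of f).tensor (Term.of g))
  -- symmetric monoidal category
  | interchange {X Y Z X' Y' Z' : C} (s : Term C X Y) (t : Term C Y Z)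
      (s' : Term C X' Y') (t' : Term C Y' Z') :
      Rel ((s.tensor s').comp (t.tensor t')) ((s.comp t).tensor (s'.comp t'))
  | associator_naturality {X X' Y Y' Z Z' : C}
      (s : Term C X X') (t : Term C Y Y') (r : Term C Z Z') :
      Rel (((s.tensor t).tensor r).comp (Term.of (α_ X' Y' Z').hom))
        ((Term.of (α_ X Y Z).hom).comp (s.tensor (t.tensor r)))
  | leftUnitor_naturality {X Y : C} (s : Term C X Y) :
      Rel (((Term.of (𝟙 (𝟙_ C))).tensor s).comp (Term.of (λ_ Y).hom))
        ((Term.of (λ_ X).hom).comp s)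
  | rightUnitor_naturality {X Y : C} (s : Term C X Y) :
      Rel ((s.tensor (Term.of (𝟙 (𝟙_ C)))).comp (Term.of (ρ_ Y).hom))
        ((Term.of (ρ_ X).hom).comp s)
  | braiding_naturality {X Y X' Y' : C} (s : Term C X Y) (t : Term C X' Y') :
      Rel ((s.tensor t).comp (Term.of (β_ Y Y').hom))
        ((Term.of (β_ X X').hom).comp (t.tensor s))
  -- observations are compatible with the tensor, `(x ⊗ y)° = x° ⊗ y°` and `id_I° = id_I`
  | obs_tensor {X Y : C} (x : 𝟙_ C ⟶ X) (y : 𝟙_ C ⟶ Y)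
      (hx : IsDeterministic x) (hy : IsDeterministic y) :
      Rel (Term.obs (stateTensor x y) (hx.stateTensor hy))
        (((Term.obs x hx).tensor (Term.obs y hy)).comp (Term.of (λ_ (𝟙_ C)).hom))
  | obs_unit : Rel (Term.obs (𝟙 (𝟙_ C)) (IsDeterministic.id (𝟙_ C))) (Term.of (𝟙 (𝟙_ C)))
  -- the observation axiom: observing `x` on a copy and keeping the other copy is the same as
  -- observing `x` and producing `x`
  | obs_copy {X : C} (x : 𝟙_ C ⟶ X) (hx : IsDeterministic x) :
      Rel ((Term.of Δ[X]).comp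
          (((Term.obs x hx).tensor (Term.of (𝟙 X))).comp (Term.of (λ_ X).hom)))
        ((Term.obs x hx).comp (Term.of x))

/-- Formal expressions up to the axioms. -/
instance Term.setoid (X Y : C) : Setoid (Term C X Y) where
  r := Term.Rel
  iseqv := ⟨Term.Rel.refl, Term.Rel.symm, Term.Rel.trans⟩

variable (C) in
/-- The category `exact(C)` of processes with exact observations over `C`. It has the objects
of `C`. -/
structure Exact where
  /-- The object of `exact(C)` given by an object of `C`. -/
  mk ::
  /-- The underlying object of `C`. -/
  as : C

namespace Exact

instance : Category (Exact C) where
  Hom X Y := Quotient (Term.setoid X.as Y.as)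
  id X := Quotient.mk _ (Term.of (𝟙 X.as))
  comp := Quotient.map₂ Term.comp fun _ _ h _ _ h' => Term.Rel.comp_congr h h'
  id_comp := by rintro X Y ⟨s⟩; exact Quotient.sound (.id_comp s)
  comp_id := by rintro X Y ⟨s⟩; exact Quotient.sound (.comp_id s)
  assoc := by rintro X Y Z W ⟨s⟩ ⟨t⟩ ⟨r⟩; exact Quotient.sound (.assoc s t r)

/-- The morphism of `exact(C)` denoted by a formal expression. -/
def ofTerm {X Y : C} (t : Term C X Y) : (mk X : Exact C) ⟶ mk Y :=
  Quotient.mk _ t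

/-- The inclusion of `C` into `exact(C)`. -/
def incl : C ⥤ Exact C where
  obj X := mk X
  map f := ofTerm (.of f)
  map_id _ := rfl
  map_comp f g := Quotient.sound (.of_comp f g)

instance : MonoidalCategoryStruct (Exact C) where
  tensorObj X Y := mk (X.as ⊗ Y.as)
  tensorUnit := mk (𝟙_ C)
  tensorHom := Quotient.map₂ Term.tensor fun _ _ h _ _ h' => Term.Rel.tensor_congr h h'
  whiskerLeft X _ _ :=
    Quotient.map (Term.tensor (Term.of (𝟙 X.as))) fun _ _ h => .tensor_congr (.refl _) h
  whiskerRight f Y :=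
    Quotient.map (fun s => Term.tensor s (Term.of (𝟙 Y.as)))
      (fun _ _ h => .tensor_congr h (.refl _)) f
  associator X Y Z := incl.mapIso (α_ X.as Y.as Z.as)
  leftUnitor X := incl.mapIso (λ_ X.as)
  rightUnitor X := incl.mapIso (ρ_ X.as)

theorem incl_tensorHom {X Y X' Y' : C} (f : X ⟶ Y) (g : X' ⟶ Y') :
    incl.map f ⊗ₘ incl.map g = incl.map (f ⊗ₘ g) :=
  Quotient.sound (.symm (.of_tensor f g))

theorem incl_whiskerLeft (X : C) {Y Z : C} (f : Y ⟶ Z) :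
    incl.obj X ◁ incl.map f = incl.map (X ◁ f) := by
  rw [← id_tensorHom, ← incl_tensorHom]; rfl

theorem incl_whiskerRight {X Y : C} (f : X ⟶ Y) (Z : C) :
    incl.map f ▷ incl.obj Z = incl.map (f ▷ Z) := by
  rw [← tensorHom_id, ← incl_tensorHom]; rfl

instance : MonoidalCategory (Exact C) :=
  MonoidalCategory.ofTensorHom
    (id_tensorHom_id := fun X Y =>
      (incl_tensorHom (𝟙 X.as) (𝟙 Y.as)).trans (congrArg incl.map (id_tensorHom_id X.as Y.as)))
    (id_tensorHom := by rintro X Y Z ⟨s⟩; rfl)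
    (tensorHom_id := by rintro X Y ⟨s⟩ Z; rfl)
    (tensorHom_comp_tensorHom := by
      rintro X Y Z X' Y' Z' ⟨s⟩ ⟨s'⟩ ⟨t⟩ ⟨t'⟩; exact Quotient.sound (.interchange s t s' t'))
    (associator_naturality := by
      rintro X Y Z X' Y' Z' ⟨s⟩ ⟨t⟩ ⟨r⟩; exact Quotient.sound (.associator_naturality s t r))
    (leftUnitor_naturality := by rintro X Y ⟨s⟩; exact Quotient.sound (.leftUnitor_naturality s))
    (rightUnitor_naturality := by rintro X Y ⟨s⟩; exact Quotient.sound (.rightUnitor_naturality s))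
    (pentagon := fun W X Y Z => by
      have h := congrArg incl.map (pentagon W.as X.as Y.as Z.as)
      rw [← tensorHom_id, ← id_tensorHom] at h
      simp only [incl.map_comp, ← incl_tensorHom] at h
      exact h)
    (triangle := fun X Y => by
      have h := congrArg incl.map (triangle X.as Y.as)
      rw [← tensorHom_id, ← id_tensorHom] at h
      simp only [incl.map_comp, ← incl_tensorHom] at h
      exact h)

/-- The observation `x° : X ⟶ I` of a deterministic `x : I ⟶ X`. -/
def obs {X : C} (x : 𝟙_ C ⟶ X) (hx : IsDeterministic x) :
    incl.obj X ⟶ 𝟙_ (Exact C) :=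
  ofTerm (.obs x hx)

instance : SymmetricCategory (Exact C) where
  braiding X Y := incl.mapIso (β_ X.as Y.as)
  braiding_naturality_right := by
    rintro X Y Z ⟨s⟩; exact Quotient.sound (.braiding_naturality (.of (𝟙 X.as)) s)
  braiding_naturality_left := by
    rintro X Y ⟨s⟩ Z; exact Quotient.sound (.braiding_naturality s (.of (𝟙 Z.as)))
  hexagon_forward X Y Z := by
    have h := congrArg incl.map (BraidedCategory.hexagon_forward X.as Y.as Z.as)
    simp only [incl.map_comp, ← incl_whiskerLeft, ← incl_whiskerRight] at h
    exact h
  hexagon_reverse X Y Z := by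
    have h := congrArg incl.map (BraidedCategory.hexagon_reverse X.as Y.as Z.as)
    simp only [incl.map_comp, ← incl_whiskerLeft, ← incl_whiskerRight] at h
    exact h
  symmetry X Y :=
    (incl.map_comp _ _).symm.trans (congrArg incl.map (SymmetricCategory.symmetry X.as Y.as))

/-- Copying and discarding in `exact(C)` are those of `C`. -/
abbrev comonObj (X : Exact C) : ComonObj X where
  counit := incl.map ε[X.as]
  comul := incl.map Δ[X.as]
  counit_comul := by
    have h := congrArg incl.map (ComonObj.counit_comul X.as)
    simp only [incl.map_comp, ← incl_whiskerRight] at h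
    exact h
  comul_counit := by
    have h := congrArg incl.map (ComonObj.comul_counit X.as)
    simp only [incl.map_comp, ← incl_whiskerLeft] at h
    exact h
  comul_assoc := by
    have h := congrArg incl.map (ComonObj.comul_assoc X.as)
    simp only [incl.map_comp, ← incl_whiskerLeft, ← incl_whiskerRight] at h
    exact h

theorem incl_tensorμ (X₁ X₂ Y₁ Y₂ : C) :
    tensorμ (incl.obj X₁) (incl.obj X₂) (incl.obj Y₁) (incl.obj Y₂) =
      incl.map (tensorμ X₁ X₂ Y₁ Y₂) := by
  unfold tensorμ
  simp only [incl.map_comp, ← incl_whiskerLeft, ← incl_whiskerRight]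
  rfl

attribute [local instance] comonObj in
/-- `exact(C)` is a copy-discard category. -/
instance : CopyDiscardCategory (Exact C) where
  comonObj := comonObj
  isCommComonObj X :=
    { comul_comm := (incl.map_comp _ _).symm.trans
        (congrArg incl.map (IsCommComonObj.comul_comm X.as)) }
  copy_tensor X Y := by
    have h := congrArg incl.map (CopyDiscardCategory.copy_tensor X.as Y.as)
    simp only [incl.map_comp, ← incl_tensorHom, ← incl_tensorμ] at h
    exact h
  discard_tensor X Y := by
    have h := congrArg incl.map (CopyDiscardCategory.discard_tensor X.as Y.as)
    simp only [incl.map_comp, ← incl_tensorHom] at h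
    exact h
  copy_unit := congrArg incl.map (CopyDiscardCategory.copy_unit (C := C))
  discard_unit := congrArg incl.map (CopyDiscardCategory.discard_unit (C := C))

end Exact

/-- The data of a normal form `(h ; z°) ◁ g` of a process `X ⟶ Y` with exact observations: all of it
lives in `C`. -/
structure NormalForm (X Y : C) where
  /-- The type of the observation. -/
  Z : C
  /-- The observed value. -/
  z : 𝟙_ C ⟶ Z
  det : IsDeterministic z
  /-- The process that is observed. -/
  h : X ⟶ Z
  /-- The process that produces the output. -/
  g : X ⟶ Y

namespace NormalForm

/-- The process `(h ; z°) ◁ g` that a normal form stands for. -/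
def eval {X Y : C} (n : NormalForm X Y) : Exact.incl.obj X ⟶ Exact.incl.obj Y :=
  effectComp (Exact.incl.map n.h ≫ Exact.obs n.z n.det) (Exact.incl.map n.g)

/-- The normal form of a morphism of `C`. -/
def of {X Y : C} (f : X ⟶ Y) : NormalForm X Y :=
  ⟨𝟙_ C, 𝟙 _, .id _, ε[X], f⟩

/-- The normal form of an observation. -/
def obs {X : C} (x : 𝟙_ C ⟶ X) (hx : IsDeterministic x) : NormalForm X (𝟙_ C) :=
  ⟨X, x, hx, 𝟙 X, ε[X]⟩

/-- The normal form of a parallel composition. -/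
def tensor {X Y X' Y' : C} (m : NormalForm X Y) (n : NormalForm X' Y') :
    NormalForm (X ⊗ X') (Y ⊗ Y') :=
  ⟨m.Z ⊗ n.Z, stateTensor m.z n.z, m.det.stateTensor n.det, m.h ⊗ₘ n.h, m.g ⊗ₘ n.g⟩

/-- The joint process `X ⟶ n.Z ⊗ Y` whose conditionals are the Bayesian inversions of `n.h` with
respect to `m.g`. -/
def joint {X Y W : C} (m : NormalForm X Y) (n : NormalForm Y W) : X ⟶ n.Z ⊗ Y :=
  m.g ≫ Δ[Y] ≫ n.h ▷ Y

/-- The normal form of a sequential composition, computed with a Bayesian inversion `b`. -/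
def comp {X Y W : C} (m : NormalForm X Y) (n : NormalForm Y W) (b : n.Z ⊗ X ⟶ Y) :
    NormalForm X W :=
  ⟨m.Z ⊗ n.Z, stateTensor m.z n.z, m.det.stateTensor n.det, Δ[X] ≫ (m.h ⊗ₘ (m.g ≫ n.h)),
    (λ_ X).inv ≫ n.z ▷ X ≫ b ≫ n.g⟩

end NormalForm

/-- The normal form of a formal expression, computed by recursion on the expression from an
operation `cond` that assigns conditionals in `C`. -/
def Term.normalForm (cond : ∀ ⦃X Y₁ Y₂ : C⦄, (X ⟶ Y₁ ⊗ Y₂) → (Y₁ ⊗ X ⟶ Y₂)) :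
    ∀ {X Y : C}, Term C X Y → NormalForm X Y
  | _, _, .of f => .of f
  | _, _, .obs x hx => .obs x hx
  | _, _, .comp s t =>
      (s.normalForm cond).comp (t.normalForm cond)
        (cond ((s.normalForm cond).joint (t.normalForm cond)))
  | _, _, .tensor s t => (s.normalForm cond).tensor (t.normalForm cond)

end Exact

end PartialMarkov

/-! The value of a normal form is `guard p ≫ g` with `p = h ≫ z°`: a filter on the input followed by
a morphism of `C`. Filters slide through copying (`guard_comp_copy`), so prefixing one to a
conditional composition filters only its first process. Hence a conditional of `g` remains one of
`guard p ≫ g`. If `g` is total, discarding the output leaves exactly `p`, so `g` is a normalisation.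

It remains to bring every expression to this shape, and only composition is hard: in `g₁ ≫ guard (h₂
≫ z₂°)` the observation sits after `g₁` and must move before it. Disintegrate the joint process of
`h₂`-value and output into its marginal `g₁ ≫ h₂` and a Bayesian inversion `b`. The observation then
falls on a copied value, and the observation axiom `guard z° = z° ≫ z` replaces the retained copy by
the constant `z₂`, which is fed to `b` (`condComp_comp_effect`, `eval_comp`). The two filters merge
by `guard_guard`. -/

namespace PartialMarkov

/-! ### Calculus of guards in a copy-discard category. -/

section CopyDiscard

variable {C : Type u} [Category.{v} C] [MonoidalCategory C] [CopyDiscardCategory C]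

/-- Run an effect on a copy of the input, and return the input. -/
def guard {X : C} (p : X ⟶ 𝟙_ C) : X ⟶ X :=
  Δ[X] ≫ p ▷ X ≫ (λ_ X).hom

theorem effectComp_eq_guard_comp {X Y : C} (p : X ⟶ 𝟙_ C) (g : X ⟶ Y) :
    effectComp p g = guard p ≫ g := by
  unfold effectComp condComp guard
  rw [CopyDiscardCategory.copy_unit]
  simp only [Category.assoc]
  congr 2
  monoidal

/-- Coassociativity: the effect is still run just once, whether before or after the output is
copied. No determinism of `p` is needed. -/
theorem guard_comp_copy {X : C} (p : X ⟶ 𝟙_ C) :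
    guard p ≫ Δ[X] = Δ[X] ≫ guard p ▷ X := by
  simp only [guard, Category.assoc, comp_whiskerRight, ← leftUnitor_naturality]
  rw [← whisker_exchange_assoc, ComonObj.comul_assoc_assoc]
  simp

theorem guard_guard {X : C} (p q : X ⟶ 𝟙_ C) :
    guard p ≫ guard q = guard (guard p ≫ q) := by
  conv_lhs => rw [guard.eq_def q, ← Category.assoc, guard_comp_copy]
  conv_rhs => rw [guard.eq_def (guard p ≫ q)]
  simp

theorem guard_comp_discard {X : C} (p : X ⟶ 𝟙_ C) : guard p ≫ ε[X] = p := by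
  simp only [guard, Category.assoc, ← leftUnitor_naturality]
  rw [← whisker_exchange_assoc, ComonObj.comul_counit_assoc, unitors_equal,
    rightUnitor_naturality]
  simp

theorem guard_discard (X : C) : guard ε[X] = 𝟙 X := by
  simp [guard]

theorem guard_comp {X : C} (p q : X ⟶ 𝟙_ C) :
    guard p ≫ q = Δ[X] ≫ (p ⊗ₘ q) ≫ (λ_ (𝟙_ C)).hom := by
  simp [guard, MonoidalCategory.tensorHom_def]

/-- Copying a pair is copying each factor and then applying `tensorμ`, whose naturality lets the two
effects act separately. -/
theorem guard_tensor {X Y : C} (p : X ⟶ 𝟙_ C) (q : Y ⟶ 𝟙_ C) :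
    guard p ⊗ₘ guard q = guard ((p ⊗ₘ q) ≫ (λ_ (𝟙_ C)).hom) := by
  have h := tensorμ_natural p (𝟙 X) q (𝟙 Y)
  rw [id_tensorHom_id, tensorHom_id, tensorHom_id, tensorHom_id] at h
  unfold guard
  rw [CopyDiscardCategory.copy_tensor, comp_whiskerRight]
  simp only [Category.assoc]
  rw [← reassoc_of% h, ← leftUnitor_monoidal]
  simp

theorem condComp_guard_comp {X A B : C} (p : X ⟶ 𝟙_ C) (f : X ⟶ A) (g : A ⊗ X ⟶ B) :
    condComp (guard p ≫ f) g = guard p ≫ condComp f g := by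
  unfold condComp
  rw [← Category.assoc (guard p), guard_comp_copy]
  simp

/-- A conditional of `g` is a conditional of `g` guarded by an effect. -/
theorem IsConditional.effectComp {X Y₁ Y₂ : C} {g : X ⟶ Y₁ ⊗ Y₂} {c : Y₁ ⊗ X ⟶ Y₂}
    (h : IsConditional g c) (p : X ⟶ 𝟙_ C) : IsConditional (effectComp p g) c := by
  unfold IsConditional at *
  rw [effectComp_eq_guard_comp, Category.assoc, condComp_guard_comp, ← h]

/-- A total process is a normalisation of each of its guarded versions. -/
theorem isNormalisation_effectComp {X Y : C} (p : X ⟶ 𝟙_ C) {g : X ⟶ Y} (hg : g ≫ ε[Y] = ε[X]) :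
    IsNormalisation (effectComp p g) g := by
  unfold IsNormalisation
  rw [effectComp_eq_guard_comp, Category.assoc, hg, guard_comp_discard, effectComp_eq_guard_comp]

/-- If an effect `e` on `A` satisfies `Δ ≫ e ▷ A = e ≫ a`, then observing `e` on the first output
of a conditional composition feeds `a` into the second process. -/
theorem condComp_comp_effect {X A B : C} (f : X ⟶ A) (g : A ⊗ X ⟶ B) {e : A ⟶ 𝟙_ C}
    {a : 𝟙_ C ⟶ A} (h : guard e = e ≫ a) :
    condComp f g ≫ e ▷ B ≫ (λ_ B).hom =
      effectComp (f ≫ e) ((λ_ X).inv ≫ a ▷ X ≫ g) := by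
  have h' : Δ[A] ≫ e ▷ A = e ≫ a ≫ (λ_ A).inv := by
    rw [← Category.assoc e, ← h]; simp [guard]
  -- `e` and `g` act on different factors, so interchange brings `e` directly behind the copy of
  -- `A`, where the hypothesis on `e` applies.
  have key : condComp f g ≫ e ▷ B ≫ (λ_ B).hom =
      Δ[X] ≫ f ▷ X ≫ (Δ[A] ≫ e ▷ A) ▷ X ≫ (λ_ A).hom ▷ X ≫ g := by
    simp only [condComp, Category.assoc, comp_whiskerRight]
    rw [whisker_exchange_assoc]
    simp
  rw [key, h', effectComp_eq_guard_comp, guard]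
  simp

end CopyDiscard

/-! ### The inclusion into `exact(C)` and the values of normal forms. -/

section Exact

variable {C : Type u} [Category.{v} C] [MonoidalCategory C] [CopyDiscardCategory C]

namespace Exact

/-- The tensor, structural morphisms and copies of `exact(C)` are by definition images of those of
`C`, so `rfl` suffices once composites and whiskerings are distributed. -/
theorem incl_condComp {X A B : C} (f : X ⟶ A) (g : A ⊗ X ⟶ B) :
    incl.map (condComp f g) =
      condComp (A := incl.obj A) (B := incl.obj B) (incl.map f) (incl.map g) := by
  unfold condComp
  simp only [incl.map_comp, ← incl_whiskerLeft, ← incl_whiskerRight]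
  rfl

theorem incl_proj₁ (X Y : C) :
    incl.map (proj₁ X Y) = proj₁ (incl.obj X) (incl.obj Y) := by
  unfold proj₁
  simp only [incl.map_comp, ← incl_whiskerLeft]
  rfl

theorem incl_isConditional {X Y₁ Y₂ : C} {f : X ⟶ Y₁ ⊗ Y₂} {c : Y₁ ⊗ X ⟶ Y₂}
    (h : IsConditional f c) :
    IsConditional (Y₁ := incl.obj Y₁) (Y₂ := incl.obj Y₂) (incl.map f) (incl.map c) := by
  unfold IsConditional at *
  rw [← incl_proj₁]
  refine (congrArg incl.map h).trans ?_
  rw [incl_condComp, incl.map_comp]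
  rfl

theorem guard_obs {X : C} (x : 𝟙_ C ⟶ X) (hx : IsDeterministic x) :
    guard (obs x hx) = obs x hx ≫ incl.map x :=
  Quotient.sound (.obs_copy x hx)

theorem obs_stateTensor {X Y : C} (x : 𝟙_ C ⟶ X) (y : 𝟙_ C ⟶ Y)
    (hx : IsDeterministic x) (hy : IsDeterministic y) :
    obs (stateTensor x y) (hx.stateTensor hy) =
      (obs x hx ⊗ₘ obs y hy) ≫ (λ_ (𝟙_ (Exact C))).hom :=
  Quotient.sound (.obs_tensor x y hx hy)

theorem obs_id : obs (𝟙 (𝟙_ C)) (.id _) = 𝟙 (𝟙_ (Exact C)) :=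
  Quotient.sound .obs_unit

end Exact

namespace NormalForm

open Exact

/-- The effect by which a normal form guards its output process. -/
def effect {X Y : C} (n : NormalForm X Y) : incl.obj X ⟶ 𝟙_ (Exact C) :=
  incl.map n.h ≫ Exact.obs n.z n.det

theorem eval_eq {X Y : C} (n : NormalForm X Y) : n.eval = guard n.effect ≫ incl.map n.g :=
  effectComp_eq_guard_comp _ _

theorem eval_of {X Y : C} (f : X ⟶ Y) : (of f).eval = incl.map f := by
  have : (of f).effect = ε[incl.obj X] := by
    change incl.map ε[X] ≫ Exact.obs (𝟙 (𝟙_ C)) _ = _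
    rw [obs_id]
    exact Category.comp_id _
  rw [eval_eq, this, guard_discard, Category.id_comp]
  rfl

theorem eval_obs {X : C} (x : 𝟙_ C ⟶ X) (hx : IsDeterministic x) :
    (obs x hx).eval = Exact.obs x hx := by
  have : (obs x hx).effect = Exact.obs x hx := Category.id_comp _
  rw [eval_eq, this]
  exact guard_comp_discard _

theorem eval_tensor {X Y X' Y' : C} (m : NormalForm X Y) (n : NormalForm X' Y') :
    (m.tensor n).eval = (m.eval ⊗ₘ n.eval : incl.obj X ⊗ incl.obj X' ⟶ _) := by
  have : (m.tensor n).effect = (m.effect ⊗ₘ n.effect) ≫ (λ_ (𝟙_ (Exact C))).hom := by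
    change incl.map (m.h ⊗ₘ n.h) ≫ Exact.obs (stateTensor m.z n.z) _ = _
    rw [obs_stateTensor _ _ m.det n.det, ← incl_tensorHom, effect, effect,
      ← tensorHom_comp_tensorHom, Category.assoc]
    rfl
  rw [eval_eq, eval_eq, eval_eq, this, ← tensorHom_comp_tensorHom, guard_tensor, incl_tensorHom]
  rfl

/-- The Bayesian update: `hb` lets the observation made after `m.g` be moved in front of it, with
`b` run at the observed value. -/
theorem eval_comp {X Y W : C} (m : NormalForm X Y) (n : NormalForm Y W) {b : n.Z ⊗ X ⟶ Y}
    (hb : m.joint n = condComp (m.g ≫ n.h) b) : (m.comp n b).eval = m.eval ≫ n.eval := by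
  -- The paired observation splits by `obs_stateTensor`; this is the form in which `guard_guard` can
  -- separate the two filters.
  have hq : (m.comp n b).effect = guard m.effect ≫ incl.map (m.g ≫ n.h) ≫ Exact.obs n.z n.det := by
    change incl.map (Δ[X] ≫ (m.h ⊗ₘ (m.g ≫ n.h))) ≫ Exact.obs (stateTensor m.z n.z) _ = _
    rw [guard_comp, obs_stateTensor _ _ m.det n.det, effect, ← tensorHom_comp_tensorHom,
      incl_tensorHom, incl.map_comp]
    exact (Category.assoc _ _ _).trans
      (congrArg (incl.map Δ[X] ≫ ·) (Category.assoc _ _ _).symm)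
  have key : incl.map m.g ≫ guard n.effect =
      effectComp (incl.map (m.g ≫ n.h) ≫ Exact.obs n.z n.det)
        ((λ_ (incl.obj X)).inv ≫ incl.map n.z ▷ incl.obj X ≫ incl.map b) := by
    refine Eq.trans ?_ (condComp_comp_effect (incl.map (m.g ≫ n.h)) (incl.map b)
      (guard_obs n.z n.det))
    have := (incl_condComp (m.g ≫ n.h) b).symm.trans (congrArg incl.map hb.symm)
    refine Eq.trans ?_ (congrArg (· ≫ _) this.symm)
    -- Running `n.effect` on a copy of the output is forming the joint process and observing its
    -- first component.
    rw [joint, guard, effect, comp_whiskerRight, incl_whiskerRight, incl.map_comp, incl.map_comp]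
    exact (congrArg (incl.map m.g ≫ incl.map Δ[Y] ≫ ·) (Category.assoc _ _ _)).trans
      ((Category.assoc _ _ _).trans
        (congrArg (incl.map m.g ≫ ·) (Category.assoc _ _ _))).symm
  rw [eval_eq, eval_eq, eval_eq, hq, ← guard_guard, Category.assoc, Category.assoc,
    ← Category.assoc (incl.map m.g), key, effectComp_eq_guard_comp, Category.assoc]
  simp only [comp, incl.map_comp, Category.assoc, ← incl_whiskerRight]
  exact congrArg (guard m.effect ≫ guard _ ≫ (λ_ (incl.obj X)).inv ≫ ·)
    (Category.assoc _ _ _).symm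

end NormalForm

end Exact

/-! ### Correctness of the recursion, normalisations and conditionals. -/

section Markov

variable {C : Type u} [Category.{v} C] [MonoidalCategory C] [MarkovCategory C]

theorem joint_comp_proj₁ {X Y W : C} (m : NormalForm X Y) (n : NormalForm Y W) :
    m.joint n ≫ proj₁ n.Z Y = m.g ≫ n.h := by
  simp only [NormalForm.joint, proj₁, Category.assoc]
  rw [← whisker_exchange_assoc, comul_counit_assoc, rightUnitor_naturality]
  simp

theorem eval_normalForm (cond : ∀ ⦃X Y₁ Y₂ : C⦄, (X ⟶ Y₁ ⊗ Y₂) → (Y₁ ⊗ X ⟶ Y₂))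
    (hcond : ∀ ⦃X Y₁ Y₂ : C⦄ (f : X ⟶ Y₁ ⊗ Y₂), IsConditional f (cond f)) {X Y : C}
    (t : Term C X Y) : (t.normalForm cond).eval = Exact.ofTerm t := by
  induction t with
  | of f => exact NormalForm.eval_of f
  | obs x hx => exact NormalForm.eval_obs x hx
  | comp s t hs ht =>
    refine (NormalForm.eval_comp _ _ ?_).trans ((congrArg₂ (· ≫ ·) hs ht).trans rfl)
    rw [← joint_comp_proj₁]
    exact hcond _
  | tensor s t hs ht =>
    refine (NormalForm.eval_tensor _ _).trans ?_
    rw [hs, ht]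
    rfl

/-- Only `n.g` has to be total, which it is as a morphism of the Markov category `C`; the guard in
front of it need not be. -/
theorem isNormalisation_eval {X Y : C} (n : NormalForm X Y) :
    IsNormalisation n.eval (Exact.incl.map n.g) := by
  refine isNormalisation_effectComp _ ?_
  exact (Exact.incl.map_comp _ _).symm.trans
    (congrArg Exact.incl.map (MarkovCategory.discard_natural n.g))

theorem isConditional_eval {X Y₁ Y₂ : C} (n : NormalForm X (Y₁ ⊗ Y₂)) {c : Y₁ ⊗ X ⟶ Y₂}
    (hc : IsConditional n.g c) :
    IsConditional (Y₁ := Exact.incl.obj Y₁) (Y₂ := Exact.incl.obj Y₂) n.eval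
      (Exact.incl.map c) :=
  (Exact.incl_isConditional hc).effectComp _

end Markov

end PartialMarkov

open PartialMarkov in
/-- Let `C` be a Markov category (with conditionals). Then `exact(C)` is a copy-discard category with
conditionals. Every process is the value of a normal form; its component `g` is a normalisation of
the process, and conditionals of `g` in `C` are conditionals of the process in `exact(C)`. Given any
operation that assigns conditionals in `C`, a normal form of every formal expression, hence a
conditional, is computed by recursion. -/
theorem theorem5p4 {C : Type u} [Category.{v} C] [MonoidalCategory C] [MarkovCategory C]
    [HasConditionals C] :
    HasConditionals (Exact C) ∧
    (∀ {X Y : C} (f : Exact.incl.obj X ⟶ Exact.incl.obj Y), ∃ n : NormalForm X Y, f = n.eval) ∧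
    (∀ {X Y : C} (n : NormalForm X Y), IsNormalisation n.eval (Exact.incl.map n.g)) ∧
    (∀ {X Y₁ Y₂ : C} (f : Exact.incl.obj X ⟶ Exact.incl.obj Y₁ ⊗ Exact.incl.obj Y₂)
      (n : NormalForm X (Y₁ ⊗ Y₂)) (c : Y₁ ⊗ X ⟶ Y₂),
      f = n.eval → IsConditional n.g c → IsConditional f (Exact.incl.map c)) ∧
    (∀ cond : ∀ ⦃X Y₁ Y₂ : C⦄, (X ⟶ Y₁ ⊗ Y₂) → (Y₁ ⊗ X ⟶ Y₂),
      (∀ ⦃X Y₁ Y₂ : C⦄ (f : X ⟶ Y₁ ⊗ Y₂), IsConditional f (cond f)) →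
      (∀ {X Y : C} (t : Term C X Y), Exact.ofTerm t = (t.normalForm cond).eval) ∧
      (∀ {X Y₁ Y₂ : C} (t : Term C X (Y₁ ⊗ Y₂)),
        IsConditional (Y₁ := Exact.incl.obj Y₁) (Y₂ := Exact.incl.obj Y₂) (Exact.ofTerm t)
          (Exact.incl.map (cond (t.normalForm cond).g)))) := by
  have hnormal := @eval_normalForm C _ _ _
  have hconditional := @isConditional_eval C _ _ _
  have hsurj : ∀ {X Y : C} (f : Exact.incl.obj X ⟶ Exact.incl.obj Y),
      ∃ n : NormalForm X Y, f = n.eval := by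
    -- Choice turns the existence of conditionals into an operation, so that the recursion can be
    -- run on any expression representing `f`.
    choose cond hcond using
      fun ⦃X Y₁ Y₂ : C⦄ (f : X ⟶ Y₁ ⊗ Y₂) => HasConditionals.exists_conditional f
    rintro X Y ⟨t⟩
    exact ⟨t.normalForm cond, (hnormal cond hcond t).symm⟩
  refine ⟨⟨fun {X Y₁ Y₂} f => ?_⟩, hsurj, isNormalisation_eval, ?_, fun cond hcond => ⟨?_, ?_⟩⟩
  · obtain ⟨n, rfl⟩ := hsurj (X := X.as) (Y := Y₁.as ⊗ Y₂.as) f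
    obtain ⟨c, hc⟩ := HasConditionals.exists_conditional n.g
    exact ⟨Exact.incl.map c, hconditional n hc⟩
  · rintro X Y₁ Y₂ f n c rfl hc
    exact hconditional n hc
  · intro X Y t
    exact (hnormal cond hcond t).symm
  · intro X Y₁ Y₂ t
    have h := hconditional (t.normalForm cond) (hcond _)
    rwa [hnormal cond hcond t] at h
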